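/- Let $\eta$ be a non-zero complex number and let $\gamma>1$. There is a constant $A>0$, depending only on $\gamma$ and $\eta$, such that the following holds for every meromorphic function $f\not\equiv 0$ in the complex plane and every $\varepsilon>0$. There is a set $E\subset(1,\infty)$ of finite logarithmic measure, i.e. $\int_E \frac{dt}{t}<\infty$, such that: (a) for all $z$ with $|z|=r\notin E\cup[0,1]$, the points $z$ and $z+\eta$ are neither zeros nor poles of $f$, and $$\left|\log\left|\frac{f(z+\eta)}{f(z)}\right|\right|\le A\left(\frac{T(\gamma r,f)}{r}+\frac{n(\gamma r)}{r}\,(\log r)^{\gamma}\,\log^+ n(\gamma r)\right),$$ where $T(r,f)$ is the Nevanlinna characteristic of $f$ and $n(t)=n(t,f)+n(t,1/f)$ is the number of poles and zeros of $f$ in $\{|z|\le t\}$, counted with multiplicity; (b) if in addition $f$ has finite order $\sigma=\limsup_{r\to\infty}\frac{\log^+T(r,f)}{\log r}$, then for all $z$ with $|z|=r\notin E\cup[0,1]$, $$\exp\left(-r^{\sigma-1+\varepsilon}\right)\le\left|\frac{f(z+\eta)}{f(z)}\right|\le\exp\left(r^{\sigma-1+\varepsilon}\right).$$ -/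

import Mathlib

open Real Set Filter MeasureTheory

noncomputable section

namespace DifferenceQuotient

/-- The Nevanlinna characteristic `T(r, f) = m(r, f) + N(r, f)`. -/
def nevT (f : ℂ → ℂ) (r : ℝ) : ℝ := ValueDistribution.characteristic f ⊤ r

/-- `n(r, f)`: the number of poles of `f` in `|z| ≤ r`, counted with multiplicity. -/
def poleCount (f : ℂ → ℂ) (r : ℝ) : ℤ :=
  ∑ᶠ z ∈ Metric.closedBall (0 : ℂ) r, (MeromorphicOn.divisor f univ)⁻ z

/-- `n(r) = n(r, f) + n(r, 1/f)`: the number of poles and zeros of `f` in `|z| ≤ r`, counted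
with multiplicity. -/
def zeroPoleCount (f : ℂ → ℂ) (r : ℝ) : ℤ := poleCount f r + poleCount f⁻¹ r

/-- The order of growth `limsup_{r → ∞} log⁺ T(r, f) / log r`, as an extended real number. -/
def growthOrder (f : ℂ → ℂ) : EReal :=
  limsup (fun r : ℝ => ((log⁺ (nevT f r) / Real.log r : ℝ) : EReal)) atTop

/-- The set `E` of radii is measurable and `∫_E dt / t < ∞`. -/
def HasFiniteLogMeasure (E : Set ℝ) : Prop :=
  MeasurableSet E ∧ ∫⁻ t in E, ENNReal.ofReal (1 / t) < ⊤

end DifferenceQuotient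

end

namespace DifferenceQuotient

open Complex Metric MeromorphicOn in
/-- **Poisson–Jensen formula** on a circle that carries no zeros and no poles. -/
theorem circleAverage_re_herglotzRieszKernel_smul_log_norm {f : ℂ → ℂ} {R : ℝ} {w : ℂ}
    (hf : MeromorphicOn f (closedBall 0 R)) (hR : 0 < R)
    (hs : ∀ u ∈ sphere (0 : ℂ) R, meromorphicOrderAt f u = 0)
    (hw : w ∈ ball (0 : ℂ) R) (hfw : AnalyticAt ℂ f w) (hfw0 : f w ≠ 0) :
    Real.log ‖f w‖ = circleAverage ((re ∘ herglotzRieszKernel 0 w) • (Real.log ‖f ·‖)) 0 R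
      - ∑ᶠ i, (divisor f (ball 0 R) i) * Real.log ‖canonicalFactor R i w‖ := by
  have hord : meromorphicOrderAt f w = 0 := by
    rw [hfw.meromorphicNFAt.meromorphicOrderAt_eq_zero_iff]; exact hfw0
  have hwc : w ∈ closedBall (0 : ℂ) R := ball_subset_closedBall hw
  have htop : ∀ u : closedBall (0 : ℂ) R, meromorphicOrderAt f u ≠ ⊤ := by
    rw [← hf.exists_meromorphicOrderAt_ne_top_iff_forall (Metric.isConnected_closedBall hR.le)]
    exact ⟨⟨w, hwc⟩, by simp [hord]⟩
  obtain ⟨h, D⟩ := hf.exists_ecanonicalDecomp htop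
  have hsph (v : ℂ) : divisor f (sphere 0 R) v = 0 := by
    by_cases hv : v ∈ sphere (0 : ℂ) R
    · rw [divisor_apply (hf.mono_set sphere_subset_closedBall) hv, hs v hv]; rfl
    · exact Function.locallyFinsuppWithin.apply_eq_zero_of_notMem _ hv
  have hlog := D.log_norm_eq hwc hord hR
  simp only [hsph, Int.cast_zero, zero_mul, finsum_zero, sub_zero,
    hfw.meromorphicTrailingCoeffAt_of_ne_zero hfw0] at hlog
  have hP : circleAverage ((re ∘ herglotzRieszKernel 0 w) • (Real.log ‖h ·‖)) 0 R
      = Real.log ‖h w‖ :=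
    InnerProductSpace.HarmonicOnNhd.circleAverage_re_herglotzRieszKernel_smul
      (fun x hx ↦ (D.analyticOnNhd x hx).harmonicAt_log_norm (D.ne_zero x hx)) hw
  have hcongr : circleAverage ((re ∘ herglotzRieszKernel 0 w) • (Real.log ‖f ·‖)) 0 R
      = circleAverage ((re ∘ herglotzRieszKernel 0 w) • (Real.log ‖h ·‖)) 0 R := by
    apply circleAverage_congr_codiscreteWithin _ hR.ne'
    rw [abs_of_pos hR]
    filter_upwards [codiscreteWithin_mono sphere_subset_closedBall D.eventuallyEq,
      self_mem_codiscreteWithin (sphere (0 : ℂ) R)] with x hx hxs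
    have hn : ‖(∏ᶠ u, (canonicalFactor R u) ^ (-divisor f (ball 0 R) u)) x‖ = 1 := by
      have hfin : (divisor f (ball 0 R)).support.Finite := hf.divisor_ball_support_finite
      rw [finprod_eq_prod_of_mulSupport_subset (s := hfin.toFinset), Finset.prod_apply, norm_prod]
      · refine Finset.prod_eq_one fun i hi ↦ ?_
        have : i ∈ ball (0 : ℂ) R :=
          (divisor f (ball 0 R)).supportWithinDomain (by simpa using hi)
        rw [Pi.pow_apply, norm_zpow, norm_canonicalFactor_eval_circle_eq_one this hxs, one_zpow]
      · intro i
        contrapose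
        intro hi
        simp_all
    have hfx : ‖f x‖ = ‖h x‖ := by
      rw [hx]
      simp [hsph, -zpow_neg, hn]
    simp [hfx]
  rw [hcongr, hP, hlog]
  ring

theorem abs_log_sub_log_le {x y : ℝ} (hx : 0 < x) (hy : 0 < y) :
    |Real.log x - Real.log y| ≤ |x - y| * (1 / x + 1 / y) := by
  have key : ∀ {u v : ℝ}, 0 < u → 0 < v → Real.log u - Real.log v ≤ |u - v| * (1 / u + 1 / v) := by
    intro u v hu hv
    have h1 : Real.log u - Real.log v ≤ u / v - 1 := by
      rw [← Real.log_div hu.ne' hv.ne']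
      exact Real.log_le_sub_one_of_pos (by positivity)
    have h2 : u / v - 1 = (u - v) * (1 / v) := by field_simp
    have h3 : (u - v) * (1 / v) ≤ |u - v| * (1 / v) := by
      gcongr
      exact le_abs_self _
    have h4 : 0 ≤ |u - v| * (1 / u) := by positivity
    linarith
  refine abs_sub_le_iff.2 ⟨key hx hy, ?_⟩
  rw [abs_sub_comm, add_comm]
  exact key hy hx

open Complex Metric in
theorem abs_re_herglotzRieszKernel_sub_le {R ρ : ℝ} {z w x : ℂ} (hρ : ρ < R) (hz : ‖z‖ ≤ ρ)
    (hw : ‖w‖ ≤ ρ) (hx : ‖x‖ = R) :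
    |(herglotzRieszKernel 0 w x).re - (herglotzRieszKernel 0 z x).re|
      ≤ 2 * R * ‖w - z‖ / (R - ρ) ^ 2 := by
  have hlow : ∀ {v : ℂ}, ‖v‖ ≤ ρ → R - ρ ≤ ‖x - v‖ := fun {v} hv ↦ by
    have := norm_sub_norm_le x v
    linarith
  have hpos : 0 < R - ρ := by linarith
  have hzne : x - z ≠ 0 := norm_pos_iff.1 (hpos.trans_le (hlow hz))
  have hwne : x - w ≠ 0 := norm_pos_iff.1 (hpos.trans_le (hlow hw))
  have hR : 0 ≤ R := hx ▸ norm_nonneg x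
  rw [← sub_re]
  refine (abs_re_le_norm _).trans ?_
  have : herglotzRieszKernel 0 w x - herglotzRieszKernel 0 z x
      = 2 * x * (w - z) / ((x - w) * (x - z)) := by
    simp only [herglotzRieszKernel_def, sub_zero]
    field_simp
    ring
  rw [this, norm_div, norm_mul, norm_mul, norm_mul, hx, sq]
  simp only [Complex.norm_ofNat]
  gcongr
  exacts [hlow hw, hlow hz]

open Complex Metric ComplexConjugate in
theorem abs_log_norm_canonicalFactor_sub_le {R ρ : ℝ} {z w a : ℂ} (hρ : ρ < R) (hz : ‖z‖ ≤ ρ)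
    (hw : ‖w‖ ≤ ρ) (ha : ‖a‖ < R) (hza : z ≠ a) (hwa : w ≠ a) :
    |Real.log ‖canonicalFactor R a z‖ - Real.log ‖canonicalFactor R a w‖|
      ≤ ‖w - z‖ * (1 / ‖z - a‖ + 1 / ‖w - a‖ + 2 / (R - ρ)) := by
  have hρ0 : 0 ≤ ρ := (norm_nonneg z).trans hz
  have hR : 0 < R := by linarith
  have hpos : 0 < R - ρ := by linarith
  have hlow : ∀ {v : ℂ}, ‖v‖ ≤ ρ → R * (R - ρ) ≤ ‖(R : ℂ) ^ 2 - conj a * v‖ := fun {v} hv ↦ by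
    have h1 := norm_sub_norm_le ((R : ℂ) ^ 2) (conj a * v)
    have h2 : ‖(R : ℂ) ^ 2‖ = R ^ 2 := by simp
    have h3 : ‖conj a * v‖ ≤ R * ρ := by
      rw [norm_mul, RCLike.norm_conj]
      gcongr
    nlinarith
  have hRρ : 0 < R * (R - ρ) := by positivity
  have hsplit : ∀ {v : ℂ}, ‖v‖ ≤ ρ → v ≠ a → Real.log ‖canonicalFactor R a v‖
      = Real.log ‖(R : ℂ) ^ 2 - conj a * v‖ - Real.log R - Real.log ‖v - a‖ := fun {v} hv hva ↦ by
    have hva' : ‖v - a‖ ≠ 0 := by simpa [sub_eq_zero] using hva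
    rw [canonicalFactor_apply, norm_div, norm_mul, Real.log_div (hRρ.trans_le (hlow hv)).ne',
      Real.log_mul]
    · simp [abs_of_pos hR]
      ring
    · simpa using hR.ne'
    · exact hva'
    · simp only [norm_real, norm_eq_abs, abs_of_pos hR]
      positivity
  have h1 := abs_log_sub_log_le (norm_pos_iff.2 (sub_ne_zero.2 hza))
    (norm_pos_iff.2 (sub_ne_zero.2 hwa))
  have h2 := abs_log_sub_log_le (hRρ.trans_le (hlow hz)) (hRρ.trans_le (hlow hw))
  have h3 : |‖z - a‖ - ‖w - a‖| ≤ ‖w - z‖ := by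
    have := abs_norm_sub_norm_le (z - a) (w - a)
    rwa [sub_sub_sub_cancel_right, norm_sub_rev z w] at this
  have h4 : |‖(R : ℂ) ^ 2 - conj a * z‖ - ‖(R : ℂ) ^ 2 - conj a * w‖| ≤ R * ‖w - z‖ := by
    refine (abs_norm_sub_norm_le _ _).trans ?_
    rw [sub_sub_sub_cancel_left, ← mul_sub, norm_mul, RCLike.norm_conj]
    gcongr
  have h5 : |‖(R : ℂ) ^ 2 - conj a * z‖ - ‖(R : ℂ) ^ 2 - conj a * w‖|
      * (1 / ‖(R : ℂ) ^ 2 - conj a * z‖ + 1 / ‖(R : ℂ) ^ 2 - conj a * w‖)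
      ≤ ‖w - z‖ * (2 / (R - ρ)) := by
    calc _ ≤ R * ‖w - z‖ * (1 / (R * (R - ρ)) + 1 / (R * (R - ρ))) := by
          gcongr
          exacts [hlow hz, hlow hw]
      _ = _ := by field_simp; ring
  have h6 : |‖z - a‖ - ‖w - a‖| * (1 / ‖z - a‖ + 1 / ‖w - a‖)
      ≤ ‖w - z‖ * (1 / ‖z - a‖ + 1 / ‖w - a‖) := by
    gcongr
  rw [hsplit hz hza, hsplit hw hwa]
  calc _ = |(Real.log ‖(R : ℂ) ^ 2 - conj a * z‖ - Real.log ‖(R : ℂ) ^ 2 - conj a * w‖)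
        - (Real.log ‖z - a‖ - Real.log ‖w - a‖)| := by ring_nf
    _ ≤ _ := abs_sub _ _
    _ ≤ _ := by linarith

open Complex Metric in
theorem circleAverage_abs_log_norm_eq_proximity_add {f : ℂ → ℂ} (hf : Meromorphic f) (R : ℝ) :
    circleAverage (fun x ↦ |Real.log ‖f x‖|) 0 R
      = ValueDistribution.proximity f ⊤ R + ValueDistribution.proximity f⁻¹ ⊤ R := by
  have h1 : CircleIntegrable (fun x ↦ log⁺ ‖f x‖) 0 R :=
    hf.meromorphicOn.circleIntegrable_posLog_norm
  have h2 : CircleIntegrable (fun x ↦ log⁺ ‖f⁻¹ x‖) 0 R :=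
    hf.inv.meromorphicOn.circleIntegrable_posLog_norm
  rw [ValueDistribution.proximity_top, ValueDistribution.proximity_top,
    ← circleAverage_fun_add h1 h2]
  congr 1
  ext x
  simp only [Pi.inv_apply, norm_inv, posLog_apply, Real.log_inv]
  rcases le_total 0 (Real.log ‖f x‖) with h | h
  · rw [abs_of_nonneg h, max_eq_right h, max_eq_left (by linarith), add_zero]
  · rw [abs_of_nonpos h, max_eq_left h, max_eq_right (by linarith), zero_add]

open Complex Metric MeromorphicOn in
/-- The difference version of the Poisson–Jensen formula. -/
theorem abs_log_norm_div_le {f : ℂ → ℂ} {R ρ : ℝ} {z w : ℂ} (hf : Meromorphic f) (hρ : ρ < R)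
    (hz : ‖z‖ ≤ ρ) (hw : ‖w‖ ≤ ρ) (hs : ∀ u ∈ sphere (0 : ℂ) R, meromorphicOrderAt f u = 0)
    (hfz : AnalyticAt ℂ f z) (hfz0 : f z ≠ 0) (hfw : AnalyticAt ℂ f w) (hfw0 : f w ≠ 0)
    {s : Finset ℂ} (hsupp : ∀ a, divisor f univ a ≠ 0 → ‖a‖ ≤ R → a ∈ s) :
    |Real.log ‖f w / f z‖| ≤ 2 * R * ‖w - z‖ / (R - ρ) ^ 2 *
        (ValueDistribution.proximity f ⊤ R + ValueDistribution.proximity f⁻¹ ⊤ R)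
      + ‖w - z‖ * ∑ a ∈ s, |(divisor f univ a : ℝ)| *
        (1 / ‖z - a‖ + 1 / ‖w - a‖ + 2 / (R - ρ)) := by
  have hρ0 : 0 ≤ ρ := (norm_nonneg z).trans hz
  have hR : 0 < R := by linarith
  have hzb : z ∈ ball (0 : ℂ) R := by simpa using by linarith
  have hwb : w ∈ ball (0 : ℂ) R := by simpa using by linarith
  have hpos : 0 < R - ρ := by linarith
  have hdiv (a : ℂ) (ha : divisor f (ball 0 R) a ≠ 0) :
      ‖a‖ < R ∧ divisor f (ball 0 R) a = divisor f univ a := by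
    have hab : a ∈ ball (0 : ℂ) R := (divisor f (ball 0 R)).supportWithinDomain ha
    refine ⟨by simpa using hab, ?_⟩
    rw [divisor_apply hf.meromorphicOn hab, divisor_apply hf.meromorphicOn (mem_univ a)]
  have hne {v a : ℂ} (hfv : AnalyticAt ℂ f v) (hfv0 : f v ≠ 0) (ha : divisor f univ a ≠ 0) :
      v ≠ a := by
    rintro rfl
    apply ha
    rw [divisor_apply hf.meromorphicOn (mem_univ v),
      hfv.meromorphicNFAt.meromorphicOrderAt_eq_zero_iff.2 hfv0]
    rfl
  have hsum (v : ℂ) : ∑ᶠ i, (divisor f (ball 0 R) i) * Real.log ‖canonicalFactor R i v‖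
      = ∑ i ∈ s, (divisor f (ball 0 R) i) * Real.log ‖canonicalFactor R i v‖ := by
    apply finsum_eq_sum_of_support_subset
    intro a ha
    have ha0 : divisor f (ball 0 R) a ≠ 0 := by
      intro h
      simp [h] at ha
    exact hsupp a ((hdiv a ha0).2 ▸ ha0) (hdiv a ha0).1.le
  have hlogint : CircleIntegrable (fun x ↦ Real.log ‖f x‖) 0 R :=
    hf.meromorphicOn.circleIntegrable_log_norm
  have hint {v : ℂ} (hv : v ∈ ball (0 : ℂ) R) :
      CircleIntegrable ((re ∘ herglotzRieszKernel 0 v) • (Real.log ‖f ·‖)) 0 R :=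
    hlogint.continuousOn_smul
      (continuous_re.comp_continuousOn (continuousOn_herglotzRieszKernel_sphere hv))
  have e1 := circleAverage_re_herglotzRieszKernel_smul_log_norm hf.meromorphicOn hR hs hzb hfz hfz0
  have e2 := circleAverage_re_herglotzRieszKernel_smul_log_norm hf.meromorphicOn hR hs hwb hfw hfw0
  have hmain : |circleAverage ((re ∘ herglotzRieszKernel 0 w) • (Real.log ‖f ·‖)) 0 R
      - circleAverage ((re ∘ herglotzRieszKernel 0 z) • (Real.log ‖f ·‖)) 0 R|
      ≤ 2 * R * ‖w - z‖ / (R - ρ) ^ 2 *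
        (ValueDistribution.proximity f ⊤ R + ValueDistribution.proximity f⁻¹ ⊤ R) := by
    rw [← circleAverage_sub (hint hwb) (hint hzb),
      ← circleAverage_abs_log_norm_eq_proximity_add hf, ← smul_eq_mul, ← circleAverage_fun_smul]
    refine abs_circleAverage_le_circleAverage_abs.trans
      (circleAverage_mono ((hint hwb).sub (hint hzb)).abs (hlogint.abs.const_smul) ?_)
    intro x hx
    rw [abs_of_pos hR, mem_sphere_zero_iff_norm] at hx
    simp only [Pi.abs_apply, Pi.sub_apply, smul_eq_mul, Pi.mul_apply,
      Function.comp_apply]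
    rw [← sub_mul, abs_mul]
    gcongr
    exact abs_re_herglotzRieszKernel_sub_le hρ hz hw hx
  have hsums : |∑ i ∈ s, (divisor f (ball 0 R) i) * Real.log ‖canonicalFactor R i z‖
      - ∑ i ∈ s, (divisor f (ball 0 R) i) * Real.log ‖canonicalFactor R i w‖|
      ≤ ‖w - z‖ * ∑ a ∈ s, |(divisor f univ a : ℝ)| *
        (1 / ‖z - a‖ + 1 / ‖w - a‖ + 2 / (R - ρ)) := by
    rw [← Finset.sum_sub_distrib, Finset.mul_sum]
    refine (Finset.abs_sum_le_sum_abs _ _).trans (Finset.sum_le_sum fun a _ ↦ ?_)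
    by_cases ha : divisor f (ball 0 R) a = 0
    · rw [ha]
      simp only [Int.cast_zero, zero_mul, sub_self, abs_zero]
      positivity
    · obtain ⟨haR, hD⟩ := hdiv a ha
      rw [hD] at ha ⊢
      rw [← mul_sub, abs_mul, mul_left_comm]
      gcongr
      exact abs_log_norm_canonicalFactor_sub_le hρ hz hw haR (hne hfz hfz0 ha) (hne hfw hfw0 ha)
  rw [norm_div, Real.log_div (norm_ne_zero_iff.2 hfw0) (norm_ne_zero_iff.2 hfz0), e1, e2, hsum,
    hsum]
  rw [abs_le] at hmain hsums ⊢
  constructor <;> linarith [hmain.1, hmain.2, hsums.1, hsums.2]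

theorem arsinh_le_log_one_add_two_mul {x : ℝ} (hx : 0 ≤ x) :
    Real.arsinh x ≤ Real.log (1 + 2 * x) := by
  rw [Real.arsinh]
  apply Real.log_le_log (by positivity)
  have : √(1 + x ^ 2) ≤ 1 + x := Real.sqrt_le_iff.2 ⟨by positivity, by nlinarith⟩
  linarith

/-- A smooth majorant of `1 / |r - t|` off the interval of radius `δ` around `t`. -/
theorem one_div_abs_le {u δ : ℝ} (hδ : 0 < δ) (hu : δ ≤ |u|) :
    1 / |u| ≤ 2 * ((√(1 + (u / δ) ^ 2))⁻¹ * (1 / δ)) := by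
  have hu0 : 0 < |u| := hδ.trans_le hu
  have h1 : √(1 + (u / δ) ^ 2) ≤ 2 * (|u| / δ) := by
    apply Real.sqrt_le_iff.2 ⟨by positivity, ?_⟩
    rw [← sq_abs (u / δ), abs_div, abs_of_pos hδ]
    have : 1 ≤ |u| / δ := (one_le_div hδ).2 hu
    nlinarith
  have h2 : 0 < √(1 + (u / δ) ^ 2) := by positivity
  calc 1 / |u| = 2 * ((2 * (|u| / δ))⁻¹ * (1 / δ)) := by field_simp
    _ ≤ _ := by gcongr

theorem hasDerivAt_arsinh_sub_div (t δ r : ℝ) :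
    HasDerivAt (fun r ↦ Real.arsinh ((r - t) / δ))
      ((√(1 + ((r - t) / δ) ^ 2))⁻¹ * (1 / δ)) r :=
  (Real.hasDerivAt_arsinh _).comp r (((hasDerivAt_id r).sub_const t).div_const δ)

theorem integral_arsinh_deriv_le {a b t T δ : ℝ} (ha : 0 ≤ a) (hab : a ≤ b) (hδ : 0 < δ)
    (ht : |t| ≤ T) :
    ∫ r in a..b, (√(1 + ((r - t) / δ) ^ 2))⁻¹ * (1 / δ)
      ≤ 2 * Real.log (1 + 2 * ((b + T) / δ)) := by
  have hcont : Continuous fun r ↦ (√(1 + ((r - t) / δ) ^ 2))⁻¹ * (1 / δ) := by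
    refine Continuous.mul (Continuous.inv₀ (by fun_prop) fun r ↦ ?_) continuous_const
    positivity
  rw [intervalIntegral.integral_eq_sub_of_hasDerivAt
    (fun r _ ↦ hasDerivAt_arsinh_sub_div t δ r) (hcont.intervalIntegrable _ _)]
  obtain ⟨ht1, ht2⟩ := abs_le.1 ht
  have hT : 0 ≤ T := (abs_nonneg t).trans ht
  have h1 : Real.arsinh ((b - t) / δ) ≤ Real.arsinh ((b + T) / δ) :=
    Real.arsinh_le_arsinh.2 (by gcongr; linarith)
  have h2 : -Real.arsinh ((b + T) / δ) ≤ Real.arsinh ((a - t) / δ) := by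
    rw [← Real.arsinh_neg, Real.arsinh_le_arsinh, ← neg_div]
    gcongr
    linarith
  have h3 := arsinh_le_log_one_add_two_mul (x := (b + T) / δ)
    (div_nonneg (by linarith) hδ.le)
  linarith

/-- Off a small set of radii, a sum of reciprocal distances to finitely many points is small. -/
theorem exists_small_set_sum_div_abs_le {ι : Type*} (S : Finset ι) (n : ι → ℕ) (t : ι → ℝ)
    {a b T δ l : ℝ} (ha : 0 ≤ a) (hab : a ≤ b) (hδ : 0 < δ) (hl : 0 < l)
    (ht : ∀ i ∈ S, |t i| ≤ T) (hn : ∀ i ∈ S, 1 ≤ n i) :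
    ∃ E ⊆ Icc a b, MeasurableSet E ∧
      volume E ≤ ENNReal.ofReal ((∑ i ∈ S, (n i : ℝ)) *
        (2 * δ + 4 * Real.log (1 + 2 * ((b + T) / δ)) / l)) ∧
      ∀ r ∈ Icc a b, r ∉ E → (∀ i ∈ S, r ≠ t i) ∧ ∑ i ∈ S, (n i : ℝ) / |r - t i| ≤ l := by
  set g : ℝ → ℝ := fun r ↦
    ∑ i ∈ S, (n i : ℝ) * (2 * ((√(1 + ((r - t i) / δ) ^ 2))⁻¹ * (1 / δ))) with hg
  have hgi (i : ι) : Continuous fun r ↦ (√(1 + ((r - t i) / δ) ^ 2))⁻¹ * (1 / δ) := by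
    refine Continuous.mul (Continuous.inv₀ (by fun_prop) fun r ↦ ?_) continuous_const
    positivity
  have hgc : Continuous g :=
    continuous_finsetSum _ fun i _ ↦ continuous_const.mul (continuous_const.mul (hgi i))
  have hg0 (r : ℝ) : 0 ≤ g r := Finset.sum_nonneg fun i _ ↦ by positivity
  set U : Set ℝ := ⋃ i ∈ S, Ioo (t i - δ) (t i + δ)
  set V : Set ℝ := {r | l ≤ g r}
  have hU : MeasurableSet U := Finset.measurableSet_biUnion _ fun i _ ↦ measurableSet_Ioo
  have hV : MeasurableSet V := measurableSet_le measurable_const hgc.measurable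
  set M : ℝ := ∑ i ∈ S, (n i : ℝ)
  have hM0 : 0 ≤ M := Finset.sum_nonneg fun i _ ↦ by positivity
  have hUvol : volume U ≤ ENNReal.ofReal (M * (2 * δ)) := by
    calc volume U ≤ ∑ i ∈ S, volume (Ioo (t i - δ) (t i + δ)) := measure_biUnion_finset_le _ _
      _ = ∑ i ∈ S, ENNReal.ofReal (2 * δ) := by
        refine Finset.sum_congr rfl fun i _ ↦ ?_
        rw [Real.volume_Ioo]
        congr 1
        ring
      _ = ENNReal.ofReal (∑ i ∈ S, 2 * δ) := by
        rw [ENNReal.ofReal_sum_of_nonneg]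
        intro i _
        positivity
      _ ≤ _ := by
        apply ENNReal.ofReal_le_ofReal
        rw [Finset.sum_mul]
        refine Finset.sum_le_sum fun i hi ↦ ?_
        have : (1 : ℝ) ≤ n i := by exact_mod_cast hn i hi
        nlinarith
  have hgint : ∫ r in Icc a b, g r ≤ M * (4 * Real.log (1 + 2 * ((b + T) / δ))) := by
    rw [integral_Icc_eq_integral_Ioc, ← intervalIntegral.integral_of_le hab, hg,
      intervalIntegral.integral_finsetSum, Finset.sum_mul]
    · refine Finset.sum_le_sum fun i hi ↦ ?_
      rw [intervalIntegral.integral_const_mul, intervalIntegral.integral_const_mul]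
      have := integral_arsinh_deriv_le ha hab hδ (ht i hi)
      exact mul_le_mul_of_nonneg_left (by linarith) (Nat.cast_nonneg _)
    · intro i _
      exact (continuous_const.mul (continuous_const.mul (hgi i))).intervalIntegrable _ _
  have hVvol : volume (Icc a b ∩ V) ≤
      ENNReal.ofReal (M * (4 * Real.log (1 + 2 * ((b + T) / δ)) / l)) := by
    have h1 := mul_meas_ge_le_integral_of_nonneg (μ := volume.restrict (Icc a b)) (f := g)
      (Eventually.of_forall hg0) hgc.continuousOn.integrableOn_Icc l
    have h2 : (volume.restrict (Icc a b)).real V = (volume (Icc a b ∩ V)).toReal := by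
      rw [Measure.real, Measure.restrict_apply hV, inter_comm]
    rw [show {x | l ≤ g x} = V from rfl, h2] at h1
    have hfin : volume (Icc a b ∩ V) ≠ ⊤ :=
      measure_ne_top_of_subset inter_subset_left (by simp)
    rw [← ENNReal.ofReal_toReal hfin]
    apply ENNReal.ofReal_le_ofReal
    rw [← mul_div_assoc, le_div_iff₀ hl, mul_comm]
    exact h1.trans hgint
  refine ⟨Icc a b ∩ (U ∪ V), inter_subset_left, measurableSet_Icc.inter (hU.union hV), ?_, ?_⟩
  · rw [inter_union_distrib_left, mul_add]
    by_cases hb : 0 ≤ M * (4 * Real.log (1 + 2 * ((b + T) / δ)) / l)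
    · rw [ENNReal.ofReal_add (by positivity) hb]
      exact (measure_union_le _ _).trans
        (add_le_add ((measure_mono inter_subset_right).trans hUvol) hVvol)
    · exfalso
      apply hb
      refine mul_nonneg hM0 (div_nonneg ?_ hl.le)
      rcases S.eq_empty_or_nonempty with rfl | ⟨i, hi⟩
      · simp [M] at hb
      · have hT : 0 ≤ T := (abs_nonneg _).trans (ht i hi)
        have : 0 ≤ (b + T) / δ := div_nonneg (by linarith) hδ.le
        exact mul_nonneg (by norm_num) (Real.log_nonneg (by linarith))
  · intro r hr hrE
    simp only [mem_inter_iff, hr, true_and, mem_union, not_or] at hrE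
    obtain ⟨hrU, hrV⟩ := hrE
    have hdist (i) (hi : i ∈ S) : δ ≤ |r - t i| := by
      by_contra! hlt
      rw [abs_lt] at hlt
      exact hrU (mem_biUnion hi ⟨by linarith, by linarith⟩)
    refine ⟨fun i hi h ↦ ?_, ?_⟩
    · have := hdist i hi
      rw [h, sub_self, abs_zero] at this
      linarith
    · refine le_trans (Finset.sum_le_sum fun i hi ↦ ?_) (not_le.1 hrV).le
      rw [div_eq_mul_one_div]
      gcongr
      exact one_div_abs_le hδ (hdist i hi)

theorem summable_log_div_rpow {γ : ℝ} (hγ : 1 < γ) (c d : ℝ) :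
    Summable fun k : ℕ ↦ (c + d * Real.log k) / (k : ℝ) ^ γ := by
  have h1 : Summable fun k : ℕ ↦ 1 / (k : ℝ) ^ γ := Real.summable_one_div_nat_rpow.2 hγ
  have h2 : Summable fun k : ℕ ↦ Real.log k / (k : ℝ) ^ γ := by
    have h3 : Summable fun k : ℕ ↦ (2 / (γ - 1)) * (1 / (k : ℝ) ^ ((γ + 1) / 2)) :=
      (Real.summable_one_div_nat_rpow.2 (by linarith)).mul_left _
    refine Summable.of_nonneg_of_le (fun k ↦ ?_) (fun k ↦ ?_) h3
    · exact div_nonneg (Real.log_natCast_nonneg k) (by positivity)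
    · rcases Nat.eq_zero_or_pos k with rfl | hk
      · simp only [CharP.cast_eq_zero, Real.log_zero, zero_div]
        have : 0 < γ - 1 := by linarith
        positivity
      have hk' : (0 : ℝ) < k := by exact_mod_cast hk
      have h4 := Real.log_le_rpow_div hk'.le (show 0 < (γ - 1) / 2 by linarith)
      have h5 : (k : ℝ) ^ γ = (k : ℝ) ^ ((γ - 1) / 2) * (k : ℝ) ^ ((γ + 1) / 2) := by
        rw [← Real.rpow_add hk']
        congr 1
        ring
      have hγ1 : γ - 1 ≠ 0 := by linarith
      calc Real.log k / (k : ℝ) ^ γ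
          ≤ ((k : ℝ) ^ ((γ - 1) / 2) / ((γ - 1) / 2)) / (k : ℝ) ^ γ := by gcongr
        _ = _ := by
          rw [h5]
          field_simp
  refine ((h1.mul_left c).add (h2.mul_left d)).congr fun k ↦ ?_
  ring

/-- Exceptional radii in geometric blocks: off a set of finite logarithmic measure, sums of
reciprocal distances are bounded by the number of points, up to logarithmic factors. -/
theorem exists_finite_log_measure_sum_div_abs_le {ι : Type*} {β γ c : ℝ} (hβ : 1 < β)
    (hγ : 1 < γ) (hc : 0 ≤ c) (S : ℕ → Finset ι) (n : ι → ℕ) (t : ι → ℝ)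
    (ht : ∀ k, ∀ i ∈ S k, |t i| ≤ c * β ^ k) (hn : ∀ k, ∀ i ∈ S k, 1 ≤ n i) :
    ∃ E ⊆ Ioi (1 : ℝ), HasFiniteLogMeasure E ∧
      ∀ k : ℕ, 1 ≤ k → 2 ≤ ∑ i ∈ S k, n i → ∀ r ∈ Icc (β ^ k) (β ^ (k + 1)), r ∉ E →
        (∀ i ∈ S k, r ≠ t i) ∧ ∑ i ∈ S k, (n i : ℝ) / |r - t i| ≤
          (∑ i ∈ S k, (n i : ℝ)) / r * Real.log r ^ γ * Real.log (∑ i ∈ S k, (n i : ℝ)) := by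
  have hβ0 : 0 < β := by linarith
  have hlogβ : 0 < Real.log β := Real.log_pos hβ
  set K : ℝ := 1 + 2 * (β + c) with hK
  have hK1 : 1 ≤ K := by linarith
  set C₁ : ℝ := 4 * β / Real.log β ^ γ with hC₁
  have hC₁0 : 0 < C₁ := by positivity
  set e : ℕ → ℝ := fun k ↦
    ((2 + C₁ + C₁ * (Real.log K / Real.log 2)) + C₁ * γ / Real.log 2 * Real.log k)
      / (k : ℝ) ^ γ with he
  have hlog2 : 0 < Real.log 2 := Real.log_pos one_lt_two
  have hlogK : 0 ≤ Real.log K := Real.log_nonneg hK1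
  have he0 (k : ℕ) : 0 ≤ e k := by
    have := Real.log_natCast_nonneg k
    positivity
  have hblock (k : ℕ) : ∃ E ⊆ Icc (β ^ k) (β ^ (k + 1)), MeasurableSet E ∧ (k = 0 → E = ∅) ∧
      volume E ≤ ENNReal.ofReal (β ^ k * e k) ∧ (1 ≤ k → 2 ≤ ∑ i ∈ S k, n i →
        ∀ r ∈ Icc (β ^ k) (β ^ (k + 1)), r ∉ E →
        (∀ i ∈ S k, r ≠ t i) ∧ ∑ i ∈ S k, (n i : ℝ) / |r - t i| ≤
          (∑ i ∈ S k, (n i : ℝ)) / r * Real.log r ^ γ * Real.log (∑ i ∈ S k, (n i : ℝ))) := by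
    by_cases hk : 1 ≤ k ∧ 2 ≤ ∑ i ∈ S k, n i
    swap
    · exact ⟨∅, empty_subset _, MeasurableSet.empty, fun _ ↦ rfl, by simp,
        fun h1 h2 ↦ absurd ⟨h1, h2⟩ hk⟩
    obtain ⟨hk1, hm⟩ := hk
    set m : ℝ := ∑ i ∈ S k, (n i : ℝ) with hmdef
    have hm2 : 2 ≤ m := by rw [hmdef]; exact_mod_cast hm
    have hkpos : (0 : ℝ) < k := by exact_mod_cast hk1
    have hkγ : 1 ≤ (k : ℝ) ^ γ := Real.one_le_rpow (by exact_mod_cast hk1) (by linarith)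
    have hlogm : Real.log 2 ≤ Real.log m := Real.log_le_log two_pos hm2
    have hlogm0 : 0 < Real.log m := hlog2.trans_le hlogm
    have hlogk : 0 ≤ Real.log k := Real.log_natCast_nonneg k
    have hβk : 0 < β ^ k := by positivity
    have hle : β ^ k ≤ β ^ (k + 1) := pow_le_pow_right₀ hβ.le (Nat.le_succ k)
    set δ : ℝ := β ^ k / (m * (k : ℝ) ^ γ) with hδdef
    have hδ : 0 < δ := by positivity
    set l : ℝ := m / β ^ (k + 1) * (k * Real.log β) ^ γ * Real.log m with hldef
    have hl : 0 < l := by positivity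
    obtain ⟨E, hE, hEm, hEv, hEr⟩ := exists_small_set_sum_div_abs_le (S k) n t hβk.le hle hδ hl
      (ht k) (hn k)
    refine ⟨E, hE, hEm, fun h ↦ by omega, hEv.trans (ENNReal.ofReal_le_ofReal ?_),
      fun _ _ r hr hrE ↦ ⟨(hEr r hr hrE).1, (hEr r hr hrE).2.trans ?_⟩⟩
    · rw [← hmdef]
      have h1 : 2 * ((β ^ (k + 1) + c * β ^ k) / δ) = 2 * (β + c) * (m * (k : ℝ) ^ γ) := by
        rw [hδdef, pow_succ]
        field_simp
      have h2 : 1 + 2 * (β + c) * (m * (k : ℝ) ^ γ) ≤ K * (m * (k : ℝ) ^ γ) := by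
        have : 1 ≤ m * (k : ℝ) ^ γ := by nlinarith
        rw [hK]
        linarith
      have h3 : Real.log (1 + 2 * (β + c) * (m * (k : ℝ) ^ γ))
          ≤ Real.log K + Real.log m + γ * Real.log k := by
        refine (Real.log_le_log (by positivity) h2).trans (le_of_eq ?_)
        rw [Real.log_mul (by positivity) (by positivity), Real.log_mul (by positivity)
          (by positivity), Real.log_rpow hkpos]
        ring
      have h4 : (Real.log K + Real.log m + γ * Real.log k) / Real.log m
          ≤ 1 + (Real.log K + γ * Real.log k) / Real.log 2 := by
        have : (Real.log K + Real.log m + γ * Real.log k) / Real.log m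
            = 1 + (Real.log K + γ * Real.log k) / Real.log m := by
          field_simp
          ring
        rw [this]
        gcongr
      rw [h1]
      have hγ0 : 0 < γ := by linarith
      calc m * (2 * δ + 4 * Real.log (1 + 2 * (β + c) * (m * (k : ℝ) ^ γ)) / l)
          ≤ m * (2 * δ + 4 * (Real.log K + Real.log m + γ * Real.log k) / l) := by gcongr
        _ = β ^ k / (k : ℝ) ^ γ *
            (2 + C₁ * ((Real.log K + Real.log m + γ * Real.log k) / Real.log m)) := by
          rw [hδdef, hldef, hC₁, pow_succ, Real.mul_rpow hkpos.le hlogβ.le]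
          field_simp
        _ ≤ β ^ k / (k : ℝ) ^ γ *
            (2 + C₁ * (1 + (Real.log K + γ * Real.log k) / Real.log 2)) := by gcongr
        _ = β ^ k * e k := by
          rw [he]
          field_simp
          ring
    · rw [hldef]
      have hr0 : 0 < r := hβk.trans_le hr.1
      have hlogr : k * Real.log β ≤ Real.log r := by
        rw [← Real.log_pow]
        exact Real.log_le_log hβk hr.1
      gcongr
      exact hr.2
  choose E hEsub hEmeas hE0 hEvol hEr using hblock
  have hone (k : ℕ) : 1 ≤ β ^ k := one_le_pow₀ hβ.le
  have hpos (k : ℕ) : E k ⊆ Ioi 1 := by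
    rcases Nat.eq_zero_or_pos k with rfl | hk
    · simp [hE0 0 rfl]
    · exact fun r hr ↦ (one_lt_pow₀ hβ hk.ne').trans_le (hEsub k hr).1
  have hlogE (k : ℕ) : ∫⁻ r in E k, ENNReal.ofReal (1 / r) ≤ ENNReal.ofReal (e k) := by
    have hβk : 0 < β ^ k := by positivity
    calc ∫⁻ r in E k, ENNReal.ofReal (1 / r)
        ≤ ∫⁻ _ in E k, ENNReal.ofReal (1 / β ^ k) := by
          refine setLIntegral_mono measurable_const fun r hr ↦ ENNReal.ofReal_le_ofReal ?_
          exact one_div_le_one_div_of_le hβk (hEsub k hr).1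
      _ = ENNReal.ofReal (1 / β ^ k) * volume (E k) := setLIntegral_const _ _
      _ ≤ ENNReal.ofReal (1 / β ^ k) * ENNReal.ofReal (β ^ k * e k) := by gcongr; exact hEvol k
      _ = ENNReal.ofReal (e k) := by
        rw [← ENNReal.ofReal_mul (by positivity)]
        congr 1
        field_simp
  refine ⟨⋃ k, E k, iUnion_subset hpos, ⟨MeasurableSet.iUnion hEmeas, ?_⟩, ?_⟩
  · refine (lintegral_iUnion_le _ _).trans_lt ((ENNReal.tsum_le_tsum hlogE).trans_lt ?_)
    rw [← ENNReal.ofReal_tsum_of_nonneg he0 (summable_log_div_rpow hγ _ _)]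
    exact ENNReal.ofReal_lt_top
  · intro k hk hm r hr hrE
    exact hEr k hk hm r hr fun h ↦ hrE (mem_iUnion_of_mem k h)

theorem HasFiniteLogMeasure.union {E F : Set ℝ} (hE : HasFiniteLogMeasure E)
    (hF : HasFiniteLogMeasure F) : HasFiniteLogMeasure (E ∪ F) :=
  ⟨hE.1.union hF.1, (lintegral_union_le _ _ _).trans_lt (ENNReal.add_lt_top.2 ⟨hE.2, hF.2⟩)⟩

theorem hasFiniteLogMeasure_of_countable {E : Set ℝ} (hE : E.Countable) :
    HasFiniteLogMeasure E :=
  ⟨hE.measurableSet, by simp [Measure.restrict_eq_zero.2 (hE.measure_zero volume)]⟩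

theorem hasFiniteLogMeasure_Ioc (R : ℝ) : HasFiniteLogMeasure (Ioc 1 R) := by
  refine ⟨measurableSet_Ioc, ?_⟩
  calc ∫⁻ t in Ioc 1 R, ENNReal.ofReal (1 / t) ≤ ∫⁻ _ in Ioc 1 R, 1 := by
        refine setLIntegral_mono measurable_const fun r hr ↦ ?_
        rw [ENNReal.ofReal_le_one]
        exact (div_le_one (by linarith [hr.1])).2 hr.1.le
    _ < ⊤ := by simp

open MeromorphicOn Metric

theorem finite_closedBall_inter_support_divisor (f : ℂ → ℂ) (r : ℝ) :
    (closedBall (0 : ℂ) r ∩ (divisor f univ).support).Finite :=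
  (Function.locallyFinsupp.locallyFiniteSupport (divisor f univ)).finite_inter_support_of_isCompact
    (isCompact_closedBall 0 r)

/-- The zeros and poles of `f` in the closed disk of radius `r`. -/
noncomputable def zeroPoleFinset (f : ℂ → ℂ) (r : ℝ) : Finset ℂ :=
  (finite_closedBall_inter_support_divisor f r).toFinset

theorem mem_zeroPoleFinset {f : ℂ → ℂ} {r : ℝ} {a : ℂ} :
    a ∈ zeroPoleFinset f r ↔ ‖a‖ ≤ r ∧ divisor f univ a ≠ 0 := by
  simp [zeroPoleFinset]

theorem zeroPoleFinset_mono (f : ℂ → ℂ) {r s : ℝ} (h : r ≤ s) :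
    zeroPoleFinset f r ⊆ zeroPoleFinset f s := fun a ha ↦ by
  rw [mem_zeroPoleFinset] at ha ⊢
  exact ⟨ha.1.trans h, ha.2⟩

theorem poleCount_eq_sum (f : ℂ → ℂ) (r : ℝ) :
    poleCount f r = ∑ a ∈ zeroPoleFinset f r, (divisor f univ)⁻ a := by
  apply finsum_mem_eq_sum_of_inter_support_eq
  ext a
  simp only [mem_inter_iff, mem_closedBall, dist_zero_right, Function.mem_support,
    Finset.mem_coe, mem_zeroPoleFinset, Function.locallyFinsuppWithin.negPart_apply]
  refine ⟨fun ⟨h1, h2⟩ ↦ ⟨⟨h1, fun h ↦ h2 (by simp [h])⟩, h2⟩, fun ⟨h1, h2⟩ ↦ ⟨h1.1, h2⟩⟩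

theorem zeroPoleFinset_inv (f : ℂ → ℂ) (r : ℝ) : zeroPoleFinset f⁻¹ r = zeroPoleFinset f r := by
  ext a
  simp [mem_zeroPoleFinset, divisor_inv]

theorem zeroPoleCount_eq_sum (f : ℂ → ℂ) (r : ℝ) :
    zeroPoleCount f r = ((∑ a ∈ zeroPoleFinset f r, (divisor f univ a).natAbs : ℕ) : ℤ) := by
  rw [zeroPoleCount, poleCount_eq_sum, poleCount_eq_sum, zeroPoleFinset_inv,
    ← Finset.sum_add_distrib, Nat.cast_sum]
  refine Finset.sum_congr rfl fun a _ ↦ ?_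
  rw [divisor_inv, negPart_neg, Function.locallyFinsuppWithin.negPart_apply,
    Function.locallyFinsuppWithin.posPart_apply, Int.natCast_natAbs, add_comm,
    posPart_add_negPart]

theorem zeroPoleCount_nonneg (f : ℂ → ℂ) (r : ℝ) : 0 ≤ zeroPoleCount f r := by
  rw [zeroPoleCount_eq_sum]
  positivity

theorem zeroPoleCount_mono (f : ℂ → ℂ) : Monotone (zeroPoleCount f) := fun r s h ↦ by
  rw [zeroPoleCount_eq_sum, zeroPoleCount_eq_sum]
  exact_mod_cast Finset.sum_le_sum_of_subset (zeroPoleFinset_mono f h)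

theorem sum_natAbs_eq_zeroPoleCount (f : ℂ → ℂ) (r : ℝ) :
    ∑ a ∈ zeroPoleFinset f r, ((divisor f univ a).natAbs : ℝ) = zeroPoleCount f r := by
  rw [zeroPoleCount_eq_sum, Int.cast_natCast, Nat.cast_sum]

theorem one_le_natAbs_of_mem_zeroPoleFinset {f : ℂ → ℂ} {r : ℝ} {a : ℂ}
    (ha : a ∈ zeroPoleFinset f r) : 1 ≤ (divisor f univ a).natAbs :=
  Nat.one_le_iff_ne_zero.2 (Int.natAbs_ne_zero.2 (mem_zeroPoleFinset.1 ha).2)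

theorem nevT_nonneg (f : ℂ → ℂ) {r : ℝ} (hr : 1 ≤ r) : 0 ≤ nevT f r :=
  ValueDistribution.characteristic_nonneg hr

theorem proximity_le_nevT (f : ℂ → ℂ) {r : ℝ} (hr : 1 ≤ r) :
    ValueDistribution.proximity f ⊤ r ≤ nevT f r :=
  le_add_of_nonneg_right (ValueDistribution.logCounting_nonneg hr)

theorem exists_nevT_inv_le {f : ℂ → ℂ} (hf : Meromorphic f) :
    ∃ C : ℝ, 0 ≤ C ∧ ∀ r, nevT f⁻¹ r ≤ nevT f r + C := by
  refine ⟨max |Real.log ‖f 0‖| |Real.log ‖meromorphicTrailingCoeffAt f 0‖|, by positivity,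
    fun r ↦ ?_⟩
  have h := ValueDistribution.characteristic_sub_characteristic_inv_le hf (R := r)
  have := (abs_le.1 h).1
  simp only [nevT]
  linarith

open Classical in
/-- Points of total multiplicity `∑ |D a|` contribute to the sum of the two characteristics. -/
theorem sum_natAbs_mul_log_le_nevT_add {f : ℂ → ℂ} {r : ℝ} (hr : 1 ≤ r) {s : Finset ℂ}
    (hs : ∀ a ∈ s, ‖a‖ ≤ r) :
    ∑ a ∈ s, ((divisor f univ a).natAbs : ℝ) * (Real.log r - Real.log ‖a‖)
      ≤ nevT f r + nevT f⁻¹ r := by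
  set D := divisor f univ
  have h1 : (∑ a ∈ s, Function.locallyFinsuppWithin.single a ((D a).natAbs : ℤ)) ≤ D⁺ + D⁻ := by
    rw [Function.locallyFinsuppWithin.le_def]
    intro z
    rw [Function.locallyFinsuppWithin.coe_sum, Finset.sum_apply,
      Function.locallyFinsuppWithin.coe_add, Pi.add_apply,
      Function.locallyFinsuppWithin.posPart_apply, Function.locallyFinsuppWithin.negPart_apply,
      posPart_add_negPart]
    simp only [Function.locallyFinsuppWithin.single_apply, Finset.sum_ite_eq,
      Int.natCast_natAbs]
    split_ifs
    · exact le_rfl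
    · positivity
  have h2 := Function.locallyFinsuppWithin.logCounting_le h1 hr
  have h3 : (Function.locallyFinsuppWithin.logCounting
      (∑ a ∈ s, Function.locallyFinsuppWithin.single a ((D a).natAbs : ℤ))) r
      = ∑ a ∈ s, ((D a).natAbs : ℝ) * (Real.log r - Real.log ‖a‖) := by
    rw [map_sum, Finset.sum_apply]
    refine Finset.sum_congr rfl fun a ha ↦ ?_
    rw [Function.locallyFinsuppWithin.logCounting_single_eq_log_sub_const (hs a ha)]
    simp
  have h4 : (Function.locallyFinsuppWithin.logCounting (D⁺ + D⁻)) r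
      = ValueDistribution.logCounting f⁻¹ ⊤ r + ValueDistribution.logCounting f ⊤ r := by
    rw [map_add, Pi.add_apply, ValueDistribution.logCounting_inv,
      ValueDistribution.logCounting_zero, ValueDistribution.logCounting_top]
  rw [← h3]
  have h5 : 0 ≤ ValueDistribution.proximity f ⊤ r := ValueDistribution.proximity_nonneg r
  have h6 : 0 ≤ ValueDistribution.proximity f⁻¹ ⊤ r := ValueDistribution.proximity_nonneg r
  simp only [nevT, ValueDistribution.characteristic, Pi.add_apply]
  linarith

theorem log_two_mul_zeroPoleCount_le (f : ℂ → ℂ) {r : ℝ} (hr : 1 ≤ r) :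
    Real.log 2 * zeroPoleCount f r ≤ nevT f (2 * r) + nevT f⁻¹ (2 * r) := by
  refine le_trans ?_ (sum_natAbs_mul_log_le_nevT_add (f := f) (r := 2 * r)
    (s := zeroPoleFinset f r) (by linarith)
    fun a ha ↦ (mem_zeroPoleFinset.1 ha).1.trans (by linarith))
  rw [← sum_natAbs_eq_zeroPoleCount, Finset.mul_sum]
  refine Finset.sum_le_sum fun a ha ↦ ?_
  rw [mul_comm]
  gcongr
  have hr0 : 0 < r := by linarith
  rw [Real.log_mul two_ne_zero hr0.ne']
  have : Real.log ‖a‖ ≤ Real.log r := by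
    rcases (norm_nonneg a).eq_or_lt with h | h
    · rw [← h, Real.log_zero]
      exact Real.log_nonneg hr
    · exact Real.log_le_log h (mem_zeroPoleFinset.1 ha).1
  linarith

theorem tendsto_nevT_atTop {f : ℂ → ℂ} (hf : Meromorphic f) {a : ℂ}
    (ha : divisor f univ a ≠ 0) : Tendsto (nevT f) atTop atTop := by
  obtain ⟨C, _, hC⟩ := exists_nevT_inv_le hf
  refine tendsto_atTop_mono' (f₁ := fun r ↦ (1 / 2) * (Real.log r + (-Real.log ‖a‖ - C))) atTop ?_
    ((tendsto_atTop_add_const_right _ _ Real.tendsto_log_atTop).const_mul_atTop (by norm_num))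
  filter_upwards [eventually_ge_atTop 1, eventually_ge_atTop ‖a‖] with r hr hra
  have h1 := sum_natAbs_mul_log_le_nevT_add (f := f) (s := {a}) hr (by simpa using hra)
  rw [Finset.sum_singleton] at h1
  have h2 : (1 : ℝ) ≤ (divisor f univ a).natAbs := by
    exact_mod_cast Nat.one_le_iff_ne_zero.2 (Int.natAbs_ne_zero.2 ha)
  have h3 : 0 ≤ Real.log r - Real.log ‖a‖ := by
    rcases (norm_nonneg a).eq_or_lt with h | h
    · rw [← h, Real.log_zero, sub_zero]
      exact Real.log_nonneg hr
    · exact sub_nonneg.2 (Real.log_le_log h hra)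
  have h4 := hC r
  nlinarith

theorem growthOrder_nonneg (f : ℂ → ℂ) : 0 ≤ growthOrder f := by
  refine le_limsup_of_frequently_le (Eventually.frequently ?_)
  filter_upwards [eventually_ge_atTop 1] with r hr
  exact EReal.coe_nonneg.2 (div_nonneg posLog_nonneg (Real.log_nonneg hr))

theorem eventually_nevT_le_rpow {f : ℂ → ℂ} {σ s : ℝ} (h : growthOrder f = σ) (hs : σ < s) :
    ∀ᶠ r in atTop, nevT f r ≤ r ^ s := by
  have h1 : ∀ᶠ r : ℝ in atTop, ((log⁺ (nevT f r) / Real.log r : ℝ) : EReal) < (s : EReal) := by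
    refine eventually_lt_of_limsup_lt ?_ (by isBoundedDefault)
    rw [growthOrder] at h
    rw [h]
    exact EReal.coe_lt_coe_iff.2 hs
  filter_upwards [h1, eventually_gt_atTop 1] with r hr hr1
  rw [EReal.coe_lt_coe_iff, div_lt_iff₀ (Real.log_pos hr1), posLog_apply] at hr
  rcases le_or_gt (nevT f r) 0 with h0 | h0
  · exact h0.trans (by positivity)
  · rw [← Real.log_le_log_iff h0 (by positivity), Real.log_rpow (by linarith)]
    exact (le_max_right _ _).trans hr.le

theorem eventually_zeroPoleCount_le_rpow {f : ℂ → ℂ} (hf : Meromorphic f) {σ s : ℝ}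
    (h : growthOrder f = σ) (hs : σ < s) (hs0 : 0 < s) :
    ∃ C : ℝ, 0 < C ∧ ∀ᶠ r in atTop, (zeroPoleCount f r : ℝ) ≤ C * r ^ s := by
  obtain ⟨C, hC0, hC⟩ := exists_nevT_inv_le hf
  have hlog2 : 0 < Real.log 2 := Real.log_pos one_lt_two
  refine ⟨(2 * 2 ^ s + C) / Real.log 2, by positivity, ?_⟩
  have h2 : Tendsto (fun r : ℝ ↦ 2 * r) atTop atTop :=
    tendsto_id.const_mul_atTop two_pos
  filter_upwards [h2.eventually (eventually_nevT_le_rpow h hs), eventually_ge_atTop 1]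
    with r hr hr1
  have h3 := log_two_mul_zeroPoleCount_le f hr1
  have h4 := hC (2 * r)
  rw [Real.mul_rpow two_pos.le (by linarith)] at hr
  have h5 : 1 ≤ r ^ s := Real.one_le_rpow hr1 hs0.le
  rw [div_mul_eq_mul_div, le_div_iff₀ hlog2]
  nlinarith

theorem one_div_norm_sub_le {z a : ℂ} {d : ℝ} (hd : 0 < d) (h : d ≤ ‖a‖ - ‖z‖) :
    1 / ‖z - a‖ ≤ 1 / d :=
  one_div_le_one_div_of_le hd (h.trans (norm_sub_rev a z ▸ norm_sub_norm_le a z))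

theorem one_div_norm_sub_le' {z a : ℂ} {d : ℝ} (hd : 0 < d) (h : d ≤ ‖z‖ - ‖a‖) :
    1 / ‖z - a‖ ≤ 1 / d :=
  one_div_le_one_div_of_le hd (h.trans (norm_sub_norm_le z a))

theorem one_div_norm_sub_le_one_div_abs {z a : ℂ} (h : ‖z‖ ≠ ‖a‖) :
    1 / ‖z - a‖ ≤ 1 / |‖z‖ - ‖a‖| :=
  one_div_le_one_div_of_le (abs_pos.2 (sub_ne_zero.2 h)) (abs_norm_sub_norm_le z a)

/-- The constant in the estimate of the contributions of zeros and poles. -/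
noncomputable def sumConst (γ : ℝ) : ℝ := 2 + (3 / (√γ - 1) + 4 / (γ - 1)) / Real.log 2

theorem one_lt_sqrt_of_one_lt {γ : ℝ} (hγ : 1 < γ) : 1 < √γ := by
  rw [Real.lt_sqrt zero_le_one]
  simpa using hγ

theorem sumConst_pos {γ : ℝ} (hγ : 1 < γ) : 0 < sumConst γ := by
  have h1 : 0 < √γ - 1 := by linarith [one_lt_sqrt_of_one_lt hγ]
  have h2 : 0 < γ - 1 := by linarith
  have h3 : 0 < Real.log 2 := Real.log_pos one_lt_two
  unfold sumConst
  positivity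

/-- Contribution of the zeros and poles when there are at least two of them. -/
theorem exists_sum_le_of_two_le {f : ℂ → ℂ} (η : ℂ) {γ R₁ : ℝ} (hγ : 1 < γ)
    (h2 : 2 ≤ zeroPoleCount f R₁) :
    ∃ E ⊆ Ioi (1 : ℝ), HasFiniteLogMeasure E ∧ ∀ᶠ r in atTop, r ∉ E → ∀ z : ℂ, ‖z‖ = r →
      ∑ a ∈ zeroPoleFinset f (γ * r), |(divisor f univ a : ℝ)| *
        (1 / ‖z - a‖ + 1 / ‖z + η - a‖ + 2 / ((γ - 1) / 2 * r))
      ≤ sumConst γ * ((zeroPoleCount f (γ * r) : ℝ) / r * Real.log r ^ γ *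
          log⁺ (zeroPoleCount f (γ * r) : ℝ)) := by
  set β := √γ
  have hβ : 1 < β := one_lt_sqrt_of_one_lt hγ
  have hβ2 : β * β = γ := Real.mul_self_sqrt (by linarith)
  have hβ0 : 0 < β := by linarith
  have hγ0 : 0 < γ := by linarith
  set n : ℂ → ℕ := fun a ↦ (divisor f univ a).natAbs with hn
  set S : ℕ → Finset ℂ := fun k ↦ zeroPoleFinset f (γ * β ^ k) with hS
  have hS1 : ∀ k, ∀ a ∈ S k, 1 ≤ n a := fun k a ha ↦ one_le_natAbs_of_mem_zeroPoleFinset ha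
  obtain ⟨E₁, hE₁, hE₁m, hE₁r⟩ := exists_finite_log_measure_sum_div_abs_le hβ hγ
    (c := γ + ‖η‖) (by positivity) S n (fun a ↦ ‖a‖) (fun k a ha ↦ by
      rw [abs_norm, add_mul]
      have := (mem_zeroPoleFinset.1 ha).1
      have : 0 ≤ ‖η‖ * β ^ k := by positivity
      linarith) hS1
  obtain ⟨E₂, hE₂, hE₂m, hE₂r⟩ := exists_finite_log_measure_sum_div_abs_le hβ hγ
    (c := γ + ‖η‖) (by positivity) S n (fun a ↦ ‖a - η‖) (fun k a ha ↦ by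
      rw [abs_norm, add_mul]
      have h1 := (mem_zeroPoleFinset.1 ha).1
      have h2 := norm_sub_le a η
      have h3 : ‖η‖ * 1 ≤ ‖η‖ * β ^ k := by
        gcongr
        exact one_le_pow₀ hβ.le
      linarith) hS1
  refine ⟨E₁ ∪ E₂, union_subset hE₁ hE₂, hE₁m.union hE₂m, ?_⟩
  obtain ⟨K, hK⟩ := ((tendsto_pow_atTop_atTop_of_one_lt hβ).const_mul_atTop hγ0).eventually
    (eventually_ge_atTop R₁) |>.exists
  have hev : ∀ᶠ r in atTop, 1 ≤ Real.log r := Real.tendsto_log_atTop.eventually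
    (eventually_ge_atTop 1)
  filter_upwards [hev, eventually_ge_atTop (β ^ (K + 1)), eventually_ge_atTop 1,
    eventually_ge_atTop (2 * ‖η‖ / (β - 1))] with r hlogr hrK hr1 hrη hrE z hz
  have hr0 : 0 < r := by linarith
  obtain ⟨k, hk1, hk2⟩ := exists_nat_pow_near hr1 hβ
  have hkK : K + 1 ≤ k := by
    have := (pow_lt_pow_iff_right₀ hβ).1 (hrK.trans_lt hk2)
    omega
  have hSsub : S k ⊆ zeroPoleFinset f (γ * r) :=
    zeroPoleFinset_mono f (by gcongr)
  set N : ℝ := (zeroPoleCount f (γ * r) : ℝ) with hN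
  set m : ℝ := ∑ i ∈ S k, (n i : ℝ) with hm
  have hmN : m ≤ N := by
    rw [hN, ← sum_natAbs_eq_zeroPoleCount]
    exact Finset.sum_le_sum_of_subset_of_nonneg hSsub fun _ _ _ ↦ by positivity
  have hm2' : 2 ≤ ∑ i ∈ S k, n i := by
    have h3 : zeroPoleCount f R₁ ≤ zeroPoleCount f (γ * β ^ k) := by
      apply zeroPoleCount_mono
      refine hK.trans ?_
      gcongr
      · exact hβ.le
      · omega
    rw [zeroPoleCount_eq_sum f (γ * β ^ k)] at h3
    exact_mod_cast h2.trans h3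
  have hm2 : 2 ≤ m := by rw [hm]; exact_mod_cast hm2'
  have hN2 : 2 ≤ N := hm2.trans hmN
  have hlog2 : 0 < Real.log 2 := Real.log_pos one_lt_two
  have hpl : log⁺ N = Real.log N := posLog_eq_log (by rw [abs_of_nonneg] <;> linarith)
  set Q : ℝ := N / r * Real.log r ^ γ * log⁺ N with hQ
  have hlogN : Real.log 2 ≤ log⁺ N := hpl ▸ Real.log_le_log two_pos hN2
  have hlogrγ : 1 ≤ Real.log r ^ γ := Real.one_le_rpow hlogr hγ0.le
  have hmQ : m / r * Real.log r ^ γ * Real.log m ≤ Q := by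
    have : 0 ≤ Real.log m := Real.log_nonneg (by linarith)
    rw [hQ, hpl]
    gcongr
  have hNQ : N / r ≤ Q / Real.log 2 := by
    rw [le_div_iff₀ hlog2, hQ, mul_assoc]
    gcongr
    nlinarith
  have hmem : r ∈ Icc (β ^ k) (β ^ (k + 1)) := ⟨hk1, hk2.le⟩
  rw [mem_union, not_or] at hrE
  obtain ⟨hne1, hs1⟩ := hE₁r k (by omega) hm2' r hmem hrE.1
  obtain ⟨hne2, hs2⟩ := hE₂r k (by omega) hm2' r hmem hrE.2
  have hβ1 : 0 < β - 1 := by linarith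
  have hηr : 2 * ‖η‖ ≤ (β - 1) * r := by
    rw [div_le_iff₀ hβ1] at hrη
    linarith
  have hterm : ∀ a ∈ zeroPoleFinset f (γ * r), |(divisor f univ a : ℝ)| *
        (1 / ‖z - a‖ + 1 / ‖z + η - a‖ + 2 / ((γ - 1) / 2 * r))
      ≤ (if a ∈ S k then (n a : ℝ) / |r - ‖a‖| + (n a : ℝ) / |r - ‖a - η‖| else 0)
        + n a * ((3 / (β - 1) + 4 / (γ - 1)) / r) := by
    intro a ha
    have hna : |(divisor f univ a : ℝ)| = n a := by
      rw [hn, Nat.cast_natAbs, Int.cast_abs]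
    have hγ1 : 0 < γ - 1 := by linarith
    have h4 : 2 / ((γ - 1) / 2 * r) = 4 / (γ - 1) / r := by
      field_simp
      norm_num
    rw [hna, h4]
    split_ifs with haS
    · have h1 : 1 / ‖z - a‖ ≤ 1 / |r - ‖a‖| := by
        rw [← hz]
        exact one_div_norm_sub_le_one_div_abs (hz ▸ hne1 a haS)
      have h2 : 1 / ‖z + η - a‖ ≤ 1 / |r - ‖a - η‖| := by
        rw [← hz, show z + η - a = z - (a - η) by ring]
        exact one_div_norm_sub_le_one_div_abs (hz ▸ hne2 a haS)
      calc (n a : ℝ) * (1 / ‖z - a‖ + 1 / ‖z + η - a‖ + 4 / (γ - 1) / r)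
          ≤ n a * (1 / |r - ‖a‖| + 1 / |r - ‖a - η‖| + (3 / (β - 1) + 4 / (γ - 1)) / r) := by
            gcongr
            have : 0 < 3 / (β - 1) := by positivity
            linarith
        _ = _ := by ring
    · have hfar : β * r ≤ ‖a‖ := by
        have : ¬ ‖a‖ ≤ γ * β ^ k := fun h ↦
          haS (mem_zeroPoleFinset.2 ⟨h, (mem_zeroPoleFinset.1 ha).2⟩)
        rw [pow_succ] at hk2
        rw [← hβ2] at this
        nlinarith
      have h1 : 1 / ‖z - a‖ ≤ 1 / ((β - 1) * r) :=
        one_div_norm_sub_le (by positivity) (by rw [hz]; linarith)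
      have h2 : 1 / ‖z + η - a‖ ≤ 1 / ((β - 1) * r / 2) := by
        refine one_div_norm_sub_le (by positivity) ?_
        have := norm_add_le z η
        rw [hz] at this
        linarith
      calc (n a : ℝ) * (1 / ‖z - a‖ + 1 / ‖z + η - a‖ + 4 / (γ - 1) / r)
          ≤ n a * (1 / ((β - 1) * r) + 1 / ((β - 1) * r / 2) + 4 / (γ - 1) / r) := by gcongr
        _ = _ := by
          field_simp
          ring
  calc _ ≤ ∑ a ∈ zeroPoleFinset f (γ * r), _ := Finset.sum_le_sum hterm
    _ = (∑ a ∈ S k, (n a : ℝ) / |r - ‖a‖| + ∑ a ∈ S k, (n a : ℝ) / |r - ‖a - η‖|)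
        + N * ((3 / (β - 1) + 4 / (γ - 1)) / r) := by
      rw [Finset.sum_add_distrib, ← Finset.sum_mul, sum_natAbs_eq_zeroPoleCount,
        Finset.sum_ite_mem, Finset.inter_eq_right.2 hSsub, Finset.sum_add_distrib]
    _ ≤ (Q + Q) + (3 / (β - 1) + 4 / (γ - 1)) * (Q / Real.log 2) := by
      have hγ1 : 0 < γ - 1 := by linarith
      have : N * ((3 / (β - 1) + 4 / (γ - 1)) / r) = (3 / (β - 1) + 4 / (γ - 1)) * (N / r) := by
        ring
      rw [this]
      gcongr
      · exact hs1.trans hmQ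
      · exact hs2.trans hmQ
    _ = sumConst γ * Q := by
      rw [sumConst]
      ring

/-- Contribution of the zeros and poles when there is at most one of them. -/
theorem eventually_sum_le_of_le_one {f : ℂ → ℂ} (hf : Meromorphic f) (η : ℂ) {γ : ℝ} (hγ : 1 < γ)
    (h1 : ∀ r, zeroPoleCount f r ≤ 1) :
    ∀ᶠ r in atTop, ∀ z : ℂ, ‖z‖ = r →
      ∑ a ∈ zeroPoleFinset f (γ * r), |(divisor f univ a : ℝ)| *
        (1 / ‖z - a‖ + 1 / ‖z + η - a‖ + 2 / ((γ - 1) / 2 * r))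
      ≤ (4 + 4 / (γ - 1)) * (nevT f (γ * r) / r) := by
  have hγ0 : 0 < γ := by linarith
  have hγ1 : 0 < γ - 1 := by linarith
  have hγr : Tendsto (fun r : ℝ ↦ γ * r) atTop atTop := tendsto_id.const_mul_atTop hγ0
  by_cases hD : ∀ a, divisor f univ a = 0
  · filter_upwards [hγr.eventually (eventually_ge_atTop 1), eventually_gt_atTop 0] with r hr hr0 z _
    have := nevT_nonneg f hr
    simp only [hD, Int.cast_zero, abs_zero, zero_mul, Finset.sum_const_zero]
    positivity
  push Not at hD
  obtain ⟨b, hb⟩ := hD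
  have huniq (a : ℂ) (ha : divisor f univ a ≠ 0) : a = b := by
    by_contra hab
    have h2 : ({a, b} : Finset ℂ) ⊆ zeroPoleFinset f (max ‖a‖ ‖b‖) := by
      intro c hc
      rw [Finset.mem_insert, Finset.mem_singleton] at hc
      rcases hc with rfl | rfl
      · exact mem_zeroPoleFinset.2 ⟨le_max_left _ _, ha⟩
      · exact mem_zeroPoleFinset.2 ⟨le_max_right _ _, hb⟩
    have h3 := h1 (max ‖a‖ ‖b‖)
    rw [zeroPoleCount_eq_sum] at h3
    have h4 := Finset.sum_le_sum_of_subset (f := fun a ↦ (divisor f univ a).natAbs) h2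
    rw [Finset.sum_pair hab] at h4
    have h5 := Int.natAbs_ne_zero.2 ha
    have h6 := Int.natAbs_ne_zero.2 hb
    omega
  filter_upwards [(hγr.eventually ((tendsto_nevT_atTop hf hb).eventually (eventually_ge_atTop 1))),
    eventually_gt_atTop 0, eventually_ge_atTop (4 * ‖b‖), eventually_ge_atTop (4 * ‖η‖)]
    with r hT hr0 hrb hrη z hz
  have hN : (zeroPoleCount f (γ * r) : ℝ) ≤ 1 := by exact_mod_cast h1 (γ * r)
  have h4 : 2 / ((γ - 1) / 2 * r) = 4 / (γ - 1) / r := by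
    field_simp
    norm_num
  calc _ ≤ ∑ a ∈ zeroPoleFinset f (γ * r), ((divisor f univ a).natAbs : ℝ) *
        ((4 + 4 / (γ - 1)) / r) := by
        refine Finset.sum_le_sum fun a ha ↦ ?_
        obtain rfl := huniq a (mem_zeroPoleFinset.1 ha).2
        rw [Nat.cast_natAbs, Int.cast_abs]
        gcongr
        have h5 : 1 / ‖z - a‖ ≤ 1 / (r / 2) :=
          one_div_norm_sub_le' (by positivity) (by rw [hz]; linarith)
        have h6 : 1 / ‖z + η - a‖ ≤ 1 / (r / 2) := by
          refine one_div_norm_sub_le' (by positivity) ?_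
          have := norm_sub_norm_le z (-η)
          rw [sub_neg_eq_add, norm_neg, hz] at this
          linarith
        have h7 : 1 / (r / 2) = 2 / r := by field_simp
        rw [h4, add_div]
        have h8 : 4 / r = 2 / r + 2 / r := by ring
        linarith
    _ = zeroPoleCount f (γ * r) * ((4 + 4 / (γ - 1)) / r) := by
        rw [← Finset.sum_mul, sum_natAbs_eq_zeroPoleCount]
    _ ≤ nevT f (γ * r) * ((4 + 4 / (γ - 1)) / r) := by
        gcongr
        exact hN.trans hT
    _ = _ := by ring

theorem exists_sum_le {f : ℂ → ℂ} (hf : Meromorphic f) (η : ℂ) {γ : ℝ} (hγ : 1 < γ) :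
    ∃ E ⊆ Ioi (1 : ℝ), HasFiniteLogMeasure E ∧ ∀ᶠ r in atTop, r ∉ E → ∀ z : ℂ, ‖z‖ = r →
      ∑ a ∈ zeroPoleFinset f (γ * r), |(divisor f univ a : ℝ)| *
        (1 / ‖z - a‖ + 1 / ‖z + η - a‖ + 2 / ((γ - 1) / 2 * r))
      ≤ (sumConst γ + (4 + 4 / (γ - 1))) * (nevT f (γ * r) / r +
        (zeroPoleCount f (γ * r) : ℝ) / r * Real.log r ^ γ *
          log⁺ (zeroPoleCount f (γ * r) : ℝ)) := by
  have hγ1 : 0 < γ - 1 := by linarith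
  have hpos : ∀ {r : ℝ}, 1 ≤ r → 0 ≤ nevT f (γ * r) / r ∧
      0 ≤ (zeroPoleCount f (γ * r) : ℝ) / r * Real.log r ^ γ *
          log⁺ (zeroPoleCount f (γ * r) : ℝ) := by
    intro r hr
    have h1 := nevT_nonneg f (show 1 ≤ γ * r by nlinarith)
    have h2 : (0 : ℝ) ≤ zeroPoleCount f (γ * r) := by exact_mod_cast zeroPoleCount_nonneg f _
    have h3 := Real.log_nonneg hr
    have h4 : 0 ≤ log⁺ (zeroPoleCount f (γ * r) : ℝ) := posLog_nonneg
    constructor <;> positivity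
  have hs := sumConst_pos hγ
  have hc : 0 < 4 + 4 / (γ - 1) := by positivity
  by_cases h : ∀ r, zeroPoleCount f r ≤ 1
  · refine ⟨∅, empty_subset _, hasFiniteLogMeasure_of_countable countable_empty, ?_⟩
    filter_upwards [eventually_sum_le_of_le_one hf η hγ h, eventually_ge_atTop 1]
      with r hr hr1 _ z hz
    obtain ⟨h1, h2⟩ := hpos hr1
    exact (hr z hz).trans (mul_le_mul (by linarith) (by linarith) h1 (by linarith))
  · push Not at h
    obtain ⟨R₁, hR₁⟩ := h
    obtain ⟨E, hE, hEm, hEr⟩ := exists_sum_le_of_two_le η hγ (Int.add_one_le_iff.2 hR₁)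
    refine ⟨E, hE, hEm, ?_⟩
    filter_upwards [hEr, eventually_ge_atTop 1] with r hr hr1 hrE z hz
    obtain ⟨h1, h2⟩ := hpos hr1
    exact (hr hrE z hz).trans (mul_le_mul (by linarith) (by linarith) h2 (by linarith))

/-- The set of points at which `f` is not analytic or vanishes. -/
def singularSet (f : ℂ → ℂ) : Set ℂ := {w | ¬ (AnalyticAt ℂ f w ∧ f w ≠ 0)}

theorem countable_singularSet {f : ℂ → ℂ} (hf : Meromorphic f)
    (hord : ∀ w, meromorphicOrderAt f w ≠ ⊤) : (singularSet f).Countable := by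
  have h1 : (⋃ n : ℕ, (zeroPoleFinset f n : Set ℂ)).Countable :=
    countable_iUnion fun n ↦ (zeroPoleFinset f n).countable_toSet
  refine (hf.countable_compl_analyticAt.union h1).mono fun w hw ↦ ?_
  by_cases ha : AnalyticAt ℂ f w
  · right
    have hw0 : f w = 0 := by
      by_contra h
      exact hw ⟨ha, h⟩
    obtain ⟨n, hn⟩ := exists_nat_ge ‖w‖
    refine mem_iUnion.2 ⟨n, mem_zeroPoleFinset.2 ⟨hn, ?_⟩⟩
    rw [divisor_apply hf.meromorphicOn (mem_univ w)]
    intro h0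
    rw [WithTop.untop₀_eq_zero] at h0
    rcases h0 with h0 | h0
    · exact (ha.meromorphicNFAt.meromorphicOrderAt_eq_zero_iff.1 h0) hw0
    · exact hord w h0
  · exact Or.inl ha

theorem meromorphicOrderAt_eq_zero_of_notMem_singularSet {f : ℂ → ℂ} {w : ℂ}
    (hw : w ∉ singularSet f) : meromorphicOrderAt f w = 0 := by
  obtain ⟨h1, h2⟩ := not_not.1 hw
  exact h1.meromorphicNFAt.meromorphicOrderAt_eq_zero_iff.2 h2

/-- If the characteristic does not tend to infinity, the difference quotient has modulus one. -/
theorem log_norm_div_eq_zero {f : ℂ → ℂ} (hf : Meromorphic f)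
    (hord : ∀ w, meromorphicOrderAt f w ≠ ⊤) (hT : ¬ Tendsto (nevT f) atTop atTop) {z w : ℂ}
    (hz : z ∉ singularSet f) (hw : w ∉ singularSet f) : Real.log ‖f w / f z‖ = 0 := by
  have hD (a : ℂ) : divisor f univ a = 0 := by
    by_contra h
    exact hT (tendsto_nevT_atTop hf h)
  have hord0 (u : ℂ) : meromorphicOrderAt f u = 0 := by
    have := hD u
    rw [divisor_apply hf.meromorphicOn (mem_univ u), WithTop.untop₀_eq_zero] at this
    exact this.resolve_right (hord u)
  obtain ⟨C, hC0, hC⟩ := exists_nevT_inv_le hf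
  obtain ⟨M, hM⟩ : ∃ M, ∃ᶠ R in atTop, nevT f R < M := by
    rw [Filter.tendsto_atTop] at hT
    push Not at hT
    obtain ⟨M, hM⟩ := hT
    exact ⟨M, hM.mono fun R hR ↦ by simpa using hR⟩
  set ρ := max ‖z‖ ‖w‖
  set B : ℝ := 8 * ‖w - z‖ * (2 * M + C)
  have hlim : Tendsto (fun R : ℝ ↦ B / R) atTop (nhds 0) := tendsto_const_nhds.div_atTop tendsto_id
  rw [← abs_nonpos_iff]
  refine le_of_forall_pos_lt_add fun ε hε ↦ ?_
  obtain ⟨R, hRM, hRε, hRρ, hR1⟩ := (hM.and_eventually ((hlim.eventually_lt_const hε).and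
    ((eventually_ge_atTop (2 * ρ)).and (eventually_ge_atTop 1)))).exists
  have hρ0 : 0 ≤ ρ := (norm_nonneg z).trans (le_max_left _ _)
  have hR0 : 0 < R := by linarith
  have hdiff := abs_log_norm_div_le (R := R) (ρ := ρ) (s := ∅) hf (by linarith)
    (le_max_left ‖z‖ ‖w‖) (le_max_right ‖z‖ ‖w‖) (fun u _ ↦ hord0 u) (not_not.1 hz).1
    (not_not.1 hz).2 (not_not.1 hw).1 (not_not.1 hw).2 (fun a ha ↦ absurd (hD a) ha)
  rw [Finset.sum_empty, mul_zero, add_zero] at hdiff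
  have h1 : ValueDistribution.proximity f ⊤ R + ValueDistribution.proximity f⁻¹ ⊤ R
      ≤ 2 * M + C := by
    have := proximity_le_nevT f hR1
    have := proximity_le_nevT f⁻¹ hR1
    have := hC R
    linarith
  have h0 : 0 ≤ ValueDistribution.proximity f ⊤ R + ValueDistribution.proximity f⁻¹ ⊤ R :=
    add_nonneg (ValueDistribution.proximity_nonneg R) (ValueDistribution.proximity_nonneg R)
  calc |Real.log ‖f w / f z‖| ≤ _ := hdiff
    _ ≤ 2 * R * ‖w - z‖ / (R / 2) ^ 2 * (2 * M + C) := by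
      gcongr
      linarith
    _ = B / R := by
      simp only [B]
      field_simp
      ring
    _ < 0 + ε := by rwa [zero_add]

/-- The constant `A` of the pointwise estimate. -/
noncomputable def diffConst (η : ℂ) (γ : ℝ) : ℝ :=
  ‖η‖ * (6 * γ / ((γ - 1) / 2) ^ 2 + (sumConst γ + (4 + 4 / (γ - 1))))

theorem diffConst_pos {η : ℂ} (hη : η ≠ 0) {γ : ℝ} (hγ : 1 < γ) : 0 < diffConst η γ := by
  have h1 := sumConst_pos hγ
  have h2 : 0 < γ - 1 := by linarith
  have h3 : 0 < γ := by linarith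
  have h4 : 0 < ‖η‖ := norm_pos_iff.2 hη
  unfold diffConst
  positivity

theorem exists_abs_log_norm_div_le {f : ℂ → ℂ} (hf : Meromorphic f)
    (hord : ∀ w, meromorphicOrderAt f w ≠ ⊤) (η : ℂ) {γ : ℝ} (hγ : 1 < γ) :
    ∃ E ⊆ Ioi (1 : ℝ), HasFiniteLogMeasure E ∧ ∀ᶠ r in atTop, r ∉ E → ∀ z : ℂ, ‖z‖ = r →
      z ∉ singularSet f ∧ z + η ∉ singularSet f ∧
      |Real.log ‖f (z + η) / f z‖| ≤ diffConst η γ * (nevT f (γ * r) / r +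
        (zeroPoleCount f (γ * r) : ℝ) / r * Real.log r ^ γ *
          log⁺ (zeroPoleCount f (γ * r) : ℝ)) := by
  have hγ0 : 0 < γ := by linarith
  have hγ1 : 0 < γ - 1 := by linarith
  have hcount := countable_singularSet hf hord
  set F : Set ℝ := (norm '' singularSet f) ∪ ((fun w ↦ ‖w - η‖) '' singularSet f) ∪
    ((fun w ↦ ‖w‖ / γ) '' singularSet f) with hF
  have hFc : F.Countable := ((hcount.image _).union (hcount.image _)).union (hcount.image _)
  obtain ⟨E, hE, hEm, hEr⟩ := exists_sum_le hf η hγ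
  refine ⟨E ∪ (F ∩ Ioi 1), union_subset hE inter_subset_right,
    hEm.union (hasFiniteLogMeasure_of_countable (hFc.mono inter_subset_left)), ?_⟩
  have hreg : ∀ r, 1 < r → r ∉ E ∪ (F ∩ Ioi 1) → ∀ z : ℂ, ‖z‖ = r → z ∉ singularSet f ∧
      z + η ∉ singularSet f ∧ ∀ u ∈ sphere (0 : ℂ) (γ * r), u ∉ singularSet f := by
    intro r hr hrE z hz
    have hrF : r ∉ F := fun h ↦ hrE (Or.inr ⟨h, hr⟩)
    refine ⟨fun h ↦ hrF (Or.inl (Or.inl ⟨z, h, hz⟩)),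
      fun h ↦ hrF (Or.inl (Or.inr ⟨z + η, h, by simpa using hz⟩)),
      fun u hu h ↦ hrF (Or.inr ⟨u, h, ?_⟩)⟩
    rw [mem_sphere_zero_iff_norm] at hu
    simp only [hu]
    field_simp
  by_cases hT : Tendsto (nevT f) atTop atTop
  swap
  · filter_upwards [eventually_gt_atTop 1] with r hr hrE z hz
    obtain ⟨h1, h2, -⟩ := hreg r hr hrE z hz
    refine ⟨h1, h2, ?_⟩
    rw [log_norm_div_eq_zero hf hord hT h1 h2, abs_zero]
    have h3 := nevT_nonneg f (show 1 ≤ γ * r by nlinarith)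
    have h4 : (0 : ℝ) ≤ zeroPoleCount f (γ * r) := by exact_mod_cast zeroPoleCount_nonneg f _
    have h5 := Real.log_nonneg hr.le
    have h6 : 0 ≤ log⁺ (zeroPoleCount f (γ * r) : ℝ) := posLog_nonneg
    have h7 := sumConst_pos hγ
    unfold diffConst
    positivity
  obtain ⟨C, hC0, hC⟩ := exists_nevT_inv_le hf
  have hγr : Tendsto (fun r : ℝ ↦ γ * r) atTop atTop := tendsto_id.const_mul_atTop hγ0
  filter_upwards [hEr, eventually_gt_atTop 1,
    (hT.comp hγr).eventually (eventually_ge_atTop C),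
    eventually_ge_atTop (‖η‖ / ((γ - 1) / 2))] with r hsum hr hTC hrη hrE z hz
  obtain ⟨h1, h2, h3⟩ := hreg r hr hrE z hz
  refine ⟨h1, h2, ?_⟩
  have hr0 : 0 < r := by linarith
  have hR1 : 1 ≤ γ * r := by nlinarith
  rw [div_le_iff₀ (by positivity)] at hrη
  have hρ : γ * r - (1 + (γ - 1) / 2) * r = (γ - 1) / 2 * r := by ring
  have hdiff := abs_log_norm_div_le (R := γ * r) (ρ := (1 + (γ - 1) / 2) * r) (z := z)
    (w := z + η) (s := zeroPoleFinset f (γ * r)) hf (by nlinarith) (by rw [hz]; nlinarith)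
    ((norm_add_le _ _).trans (by rw [hz]; linarith))
    (fun u hu ↦ meromorphicOrderAt_eq_zero_of_notMem_singularSet (h3 u hu))
    (not_not.1 h1).1 (not_not.1 h1).2 (not_not.1 h2).1 (not_not.1 h2).2
    (fun a ha har ↦ mem_zeroPoleFinset.2 ⟨har, ha⟩)
  rw [hρ, add_sub_cancel_left] at hdiff
  have hprox : ValueDistribution.proximity f ⊤ (γ * r)
      + ValueDistribution.proximity f⁻¹ ⊤ (γ * r) ≤ 3 * nevT f (γ * r) := by
    have := proximity_le_nevT f hR1
    have := proximity_le_nevT f⁻¹ hR1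
    have := hC (γ * r)
    simp only [Function.comp_apply] at hTC
    linarith
  set Q := (zeroPoleCount f (γ * r) : ℝ) / r * Real.log r ^ γ *
          log⁺ (zeroPoleCount f (γ * r) : ℝ) with hQ
  have hQ0 : 0 ≤ Q := by
    have h4 : (0 : ℝ) ≤ zeroPoleCount f (γ * r) := by exact_mod_cast zeroPoleCount_nonneg f _
    have h5 := Real.log_nonneg hr.le
    have h6 : 0 ≤ log⁺ (zeroPoleCount f (γ * r) : ℝ) := posLog_nonneg
    positivity
  have hs := hsum (fun h ↦ hrE (Or.inl h)) z hz
  calc _ ≤ _ := hdiff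
    _ ≤ 2 * (γ * r) * ‖η‖ / ((γ - 1) / 2 * r) ^ 2 * (3 * nevT f (γ * r)) + ‖η‖ *
        ((sumConst γ + (4 + 4 / (γ - 1))) * (nevT f (γ * r) / r + Q)) := by gcongr
    _ = ‖η‖ * (6 * γ / ((γ - 1) / 2) ^ 2) * (nevT f (γ * r) / r) + ‖η‖ *
        ((sumConst γ + (4 + 4 / (γ - 1))) * (nevT f (γ * r) / r + Q)) := by
      field_simp
      ring
    _ ≤ ‖η‖ * (6 * γ / ((γ - 1) / 2) ^ 2) * (nevT f (γ * r) / r + Q) + ‖η‖ *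
        ((sumConst γ + (4 + 4 / (γ - 1))) * (nevT f (γ * r) / r + Q)) := by
      gcongr
      linarith
    _ = _ := by
      unfold diffConst
      ring

/-- For functions of finite order, the bound of the pointwise estimate is a power of `r`. -/
theorem eventually_bound_le_rpow {f : ℂ → ℂ} (hf : Meromorphic f) {σ ε γ A : ℝ} (hγ : 1 < γ)
    (hA : 0 < A) (hσ : growthOrder f = σ) (hε : 0 < ε) :
    ∀ᶠ r in atTop, A * (nevT f (γ * r) / r + (zeroPoleCount f (γ * r) : ℝ) / r *
      Real.log r ^ γ * log⁺ (zeroPoleCount f (γ * r) : ℝ)) ≤ r ^ (σ - 1 + ε) := by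
  have hγ0 : 0 < γ := by linarith
  have hσ0 : 0 ≤ σ := by
    have := growthOrder_nonneg f
    rw [hσ] at this
    exact_mod_cast this
  set s : ℝ := σ + ε / 2 with hs
  have hs0 : 0 < s := by positivity
  obtain ⟨C, hC0, hC⟩ := eventually_zeroPoleCount_le_rpow hf hσ (show σ < s by linarith) hs0
  have hγr : Tendsto (fun r : ℝ ↦ γ * r) atTop atTop := tendsto_id.const_mul_atTop hγ0
  set c : ℝ := log⁺ (C * γ ^ s) with hc
  have hc0 : 0 ≤ c := posLog_nonneg
  set B : ℝ := A * (γ ^ s + C * γ ^ s * (c + s)) with hB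
  have hB0 : 0 < B := by positivity
  have hlo := (isLittleO_log_rpow_rpow_atTop (γ + 1) (show 0 < ε / 2 by positivity)).def
    (show 0 < 1 / B by positivity)
  filter_upwards [hγr.eventually hC, hγr.eventually (eventually_nevT_le_rpow hσ
    (show σ < s by linarith)), hlo, Real.tendsto_log_atTop.eventually (eventually_ge_atTop 1),
    eventually_ge_atTop 1] with r hn hT hl hlog hr
  have hr0 : 0 < r := by linarith
  rw [Real.mul_rpow hγ0.le hr0.le] at hn hT
  have hn0 : (0 : ℝ) ≤ zeroPoleCount f (γ * r) := by exact_mod_cast zeroPoleCount_nonneg f _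
  have hlogn : log⁺ (zeroPoleCount f (γ * r) : ℝ) ≤ (c + s) * Real.log r := by
    calc log⁺ (zeroPoleCount f (γ * r) : ℝ) ≤ log⁺ (C * γ ^ s * r ^ s) :=
          posLog_le_posLog hn0 (by linarith)
      _ ≤ c + log⁺ (r ^ s) := posLog_mul
      _ = c + s * Real.log r := by
        rw [posLog_eq_log (by rw [abs_of_nonneg (by positivity)]; exact Real.one_le_rpow hr hs0.le),
          Real.log_rpow hr0]
      _ ≤ (c + s) * Real.log r := by nlinarith
  have hlogγ : 1 ≤ Real.log r ^ (γ + 1) := Real.one_le_rpow hlog (by linarith)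
  have hlogadd : Real.log r ^ (γ + 1) = Real.log r ^ γ * Real.log r :=
    Real.rpow_add_one (by linarith) γ
  rw [Real.norm_of_nonneg (by positivity), Real.norm_of_nonneg (by positivity),
    one_div_mul_eq_div, le_div_iff₀ hB0] at hl
  have hrs : r ^ s / r = r ^ (s - 1) := by rw [Real.rpow_sub_one hr0.ne']
  have hlog0 : 0 ≤ log⁺ (zeroPoleCount f (γ * r) : ℝ) := posLog_nonneg
  calc A * (nevT f (γ * r) / r + (zeroPoleCount f (γ * r) : ℝ) / r *
      Real.log r ^ γ * log⁺ (zeroPoleCount f (γ * r) : ℝ))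
      ≤ A * (γ ^ s * r ^ s / r + C * (γ ^ s * r ^ s) / r *
          Real.log r ^ γ * ((c + s) * Real.log r)) := by gcongr
    _ = r ^ (s - 1) * (A * (γ ^ s * 1 + C * γ ^ s * (c + s) * Real.log r ^ (γ + 1))) := by
      rw [← hrs, hlogadd]
      ring
    _ ≤ r ^ (s - 1) * (A * (γ ^ s * Real.log r ^ (γ + 1)
          + C * γ ^ s * (c + s) * Real.log r ^ (γ + 1))) := by gcongr
    _ = r ^ (s - 1) * (Real.log r ^ (γ + 1) * B) := by
      rw [hB]
      ring
    _ ≤ r ^ (s - 1) * r ^ (ε / 2) := by gcongr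
    _ = r ^ (σ - 1 + ε) := by
      rw [← Real.rpow_add hr0]
      congr 1
      rw [hs]
      ring

end DifferenceQuotient

open DifferenceQuotient in
/-- `f` is meromorphic in the plane and not identically zero. The constant `A` depends on `γ` and
`η` only. As `f` is given as a total function, the conclusion includes that off the exceptional
radii `z` and `z + η` are neither poles nor zeros of `f`, so that the quotient has its meaning. -/
theorem mainTheorem7 (η : ℂ) (hη : η ≠ 0) (γ : ℝ) (hγ : 1 < γ) :
    ∃ A : ℝ, 0 < A ∧
      ∀ f : ℂ → ℂ, Meromorphic f → (∃ w, meromorphicOrderAt f w ≠ ⊤) →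
      ∀ ε : ℝ, 0 < ε →
      ∃ E : Set ℝ, E ⊆ Set.Ioi 1 ∧ HasFiniteLogMeasure E ∧
        (∀ z : ℂ, ‖z‖ ∉ E ∪ Set.Icc 0 1 →
          (AnalyticAt ℂ f z ∧ f z ≠ 0) ∧ (AnalyticAt ℂ f (z + η) ∧ f (z + η) ≠ 0) ∧
          |Real.log ‖f (z + η) / f z‖| ≤
            A * (nevT f (γ * ‖z‖) / ‖z‖ +
              (zeroPoleCount f (γ * ‖z‖) : ℝ) / ‖z‖ * Real.log ‖z‖ ^ γ *
                log⁺ (zeroPoleCount f (γ * ‖z‖) : ℝ))) ∧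
        (∀ σ : ℝ, growthOrder f = (σ : EReal) →
          ∀ z : ℂ, ‖z‖ ∉ E ∪ Set.Icc 0 1 →
            Real.exp (-‖z‖ ^ (σ - 1 + ε)) ≤ ‖f (z + η) / f z‖ ∧
            ‖f (z + η) / f z‖ ≤ Real.exp (‖z‖ ^ (σ - 1 + ε))) := by
  refine ⟨diffConst η γ, diffConst_pos hη hγ, fun f hf hne ε hε ↦ ?_⟩
  have hord : ∀ w, meromorphicOrderAt f w ≠ ⊤ :=
    hf.exists_meromorphicOrderAt_ne_top_iff_forall.1 hne
  obtain ⟨E, hE, hEm, hEr⟩ := exists_abs_log_norm_div_le hf hord η hγ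
  have hb : ∀ᶠ r in atTop, ∀ σ : ℝ, growthOrder f = (σ : EReal) →
      diffConst η γ * (nevT f (γ * r) / r + (zeroPoleCount f (γ * r) : ℝ) / r *
        Real.log r ^ γ * log⁺ (zeroPoleCount f (γ * r) : ℝ)) ≤ r ^ (σ - 1 + ε) := by
    by_cases h : ∃ σ₀ : ℝ, growthOrder f = (σ₀ : EReal)
    · obtain ⟨σ₀, hσ₀⟩ := h
      filter_upwards [eventually_bound_le_rpow hf hγ (diffConst_pos hη hγ) hσ₀ hε]
        with r hr σ hσ
      rw [hσ₀, EReal.coe_eq_coe_iff] at hσ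
      exact hσ ▸ hr
    · exact Eventually.of_forall fun r σ hσ ↦ absurd ⟨σ, hσ⟩ h
  obtain ⟨R₀, hR₀⟩ := eventually_atTop.1 (hEr.and hb)
  have key : ∀ z : ℂ, ‖z‖ ∉ (E ∪ Ioc 1 R₀) ∪ Icc 0 1 → R₀ ≤ ‖z‖ ∧ ‖z‖ ∉ E := by
    intro z hz
    simp only [mem_union, not_or, mem_Ioc, mem_Icc, norm_nonneg, true_and, not_and, not_le] at hz
    exact ⟨(hz.1.2 hz.2).le, hz.1.1⟩
  refine ⟨E ∪ Ioc 1 R₀, union_subset hE fun r hr ↦ hr.1,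
    hEm.union (hasFiniteLogMeasure_Ioc R₀), fun z hz ↦ ?_, fun σ hσ z hz ↦ ?_⟩
  · obtain ⟨h1, h2⟩ := key z hz
    obtain ⟨h3, h4, h5⟩ := (hR₀ _ h1).1 h2 z rfl
    exact ⟨not_not.1 h3, not_not.1 h4, h5⟩
  · obtain ⟨h1, h2⟩ := key z hz
    obtain ⟨h3, h4, h5⟩ := (hR₀ _ h1).1 h2 z rfl
    have h6 := abs_le.1 (h5.trans ((hR₀ _ h1).2 σ hσ))
    have hpos : 0 < ‖f (z + η) / f z‖ :=
      norm_pos_iff.2 (div_ne_zero (not_not.1 h4).2 (not_not.1 h3).2)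
    rw [← Real.le_log_iff_exp_le hpos, ← Real.log_le_iff_le_exp hpos]
    exact h6
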